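/- For each $n\in\mathbb N$ let $\mathcal H_n^A,\mathcal H_n^B$ be finite-dimensional complex Hilbert spaces and let $|\phi_n\rangle\in\mathcal H_n^A\otimes\mathcal H_n^B$ be a unit vector. Write $\phi_n^{AB}=|\phi_n\rangle\langle\phi_n|$, $\phi_n^A=\mathrm{Tr}_B\,\phi_n^{AB}$, $\widehat\phi^{AB}=\{\phi_n^{AB}\}_n$ and $\widehat\phi^{A}=\{\phi_n^{A}\}_n$. For $M\ge 1$ let $\Phi_M$ be the maximally entangled pure state $|\Phi_M\rangle=M^{-1/2}\sum_{i=1}^M|i\rangle\otimes|i\rangle\in\mathbb C^M\otimes\mathbb C^M$ of Schmidt rank $M$. A real number $R$ is called achievable for $\widehat\phi^{AB}$ if there are integers $M_n\ge1$ with $\limsup_{n\to\infty}\frac1n\log M_n\le R$ and maps $\mathcal L_n$, each implemented by a (finite-round) protocol of local operations and classical communication from $\mathbb C^{M_n}\otimes\mathbb C^{M_n}$ to $\mathcal H_n^A\otimes\mathcal H_n^B$, such that $\lim_{n\to\infty}\|\mathcal L_n(\Phi_{M_n})-\phi_n^{AB}\|_1=0$, where $\|A\|_1=\mathrm{Tr}|A|$.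 The entanglement dilution rate (entanglement cost) is $R^*(\widehat\phi^{AB})=\inf\{R\in\mathbb R: R\text{ is achievable}\}$. The sup-spectral entropy rate of a sequence $\widehat\rho=\{\rho_n\}$ of density operators is $$\overline H(\widehat\rho)=-\sup\Bigl\{a\in\mathbb R:\ \liminf_{n\to\infty}\mathrm{Tr}\,\rho_n\{\rho_n-e^{na}I_n>0\}\ge 1\Bigr\},$$ where $\{A>0\}$ is the spectral projection of the Hermitian operator $A$ onto its eigenvalues that are $>0$. The infimum and supremum are taken in $[-\infty,\infty]$ (so $\inf\emptyset=+\infty$, $\sup\emptyset=-\infty$), and $\log$ is the natural logarithm. Then $$R^*(\widehat\phi^{AB})=\overline H(\widehat\phi^{A}).$$ -/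

import Mathlib

open Filter Topology
open scoped Matrix Kronecker

noncomputable section

/-- Operators on `ℂ^a ⊗ ℂ^b`, written in the product basis. -/
abbrev BipartiteOp (a b : ℕ) : Type := Matrix (Fin a × Fin b) (Fin a × Fin b) ℂ

/-- Vectors of the Hilbert space `ℂ^a ⊗ ℂ^b`, written in the product basis. -/
abbrev BipartiteKet (a b : ℕ) : Type := EuclideanSpace ℂ (Fin a × Fin b)

/-- The operator `|ψ⟩⟨ψ|`. -/
def pureState {a b : ℕ} (ψ : BipartiteKet a b) : BipartiteOp a b :=
  Matrix.of fun i j => ψ i * star (ψ j)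

/-- The partial trace over the second factor. -/
def traceB {a b : ℕ} (ρ : BipartiteOp a b) : Matrix (Fin a) (Fin a) ℂ :=
  Matrix.of fun i j => ∑ k : Fin b, ρ (i, k) (j, k)

/-- The trace norm `‖A‖₁ = Tr |A|`, where `|A| = √(A† A)`. -/
def traceNorm {ι : Type*} [Fintype ι] [DecidableEq ι] (A : Matrix ι ι ℂ) : ℝ :=
  (cfc Real.sqrt (Aᴴ * A)).trace.re

/-- The spectral projection `{A > 0}` of a Hermitian operator `A`. -/
def posProj {ι : Type*} [Fintype ι] [DecidableEq ι] (A : Matrix ι ι ℂ) : Matrix ι ι ℂ :=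
  cfc (fun x : ℝ => if 0 < x then (1 : ℝ) else 0) A

/-- `IsLOCC a' b' a b L`: the map `L`, from operators on `ℂ^a ⊗ ℂ^b` to operators on
`ℂ^a' ⊗ ℂ^b'`, is implemented by a protocol of local operations and classical communication with
finitely many rounds. A protocol either stops, or one of the parties performs a local measurement,
given by Kraus operators `K x` with `∑ x, (K x)† (K x) = 1`, and announces the outcome `x`, after
which the parties follow a protocol `L x` that may depend on `x`; the outcomes are forgotten at the
end. Adjoining or discarding a local system, applying a local unitary, isometry or channel, and
keeping an outcome (or a part of it) private are special cases: the system after the measurement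
may have any dimension `c x`, and `L x` need not depend on all of `x`. -/
inductive IsLOCC (a' b' : ℕ) : (a b : ℕ) → (BipartiteOp a b → BipartiteOp a' b') → Prop
  | done : IsLOCC a' b' a' b' (fun ρ => ρ)
  | alice {a b k : ℕ} {c : Fin k → ℕ}
      (K : (x : Fin k) → Matrix (Fin (c x)) (Fin a) ℂ)
      (hK : ∑ x, (K x)ᴴ * K x = 1)
      (L : (x : Fin k) → BipartiteOp (c x) b → BipartiteOp a' b')
      (hL : ∀ x, IsLOCC a' b' (c x) b (L x)) :
      IsLOCC a' b' a b (fun ρ => ∑ x,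
        L x ((K x ⊗ₖ (1 : Matrix (Fin b) (Fin b) ℂ)) * ρ *
          (K x ⊗ₖ (1 : Matrix (Fin b) (Fin b) ℂ))ᴴ))
  | bob {a b k : ℕ} {c : Fin k → ℕ}
      (K : (x : Fin k) → Matrix (Fin (c x)) (Fin b) ℂ)
      (hK : ∑ x, (K x)ᴴ * K x = 1)
      (L : (x : Fin k) → BipartiteOp a (c x) → BipartiteOp a' b')
      (hL : ∀ x, IsLOCC a' b' a (c x) (L x)) :
      IsLOCC a' b' a b (fun ρ => ∑ x,
        L x (((1 : Matrix (Fin a) (Fin a) ℂ) ⊗ₖ K x) * ρ *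
          ((1 : Matrix (Fin a) (Fin a) ℂ) ⊗ₖ K x)ᴴ))

/-- The sequence of bipartite pure states `ψ n` can be asymptotically converted into the sequence
`φ n` by LOCC. -/
def AsympConvertible {a b a' b' : ℕ → ℕ} (ψ : (n : ℕ) → BipartiteKet (a n) (b n))
    (φ : (n : ℕ) → BipartiteKet (a' n) (b' n)) : Prop :=
  ∃ L : (n : ℕ) → BipartiteOp (a n) (b n) → BipartiteOp (a' n) (b' n),
    (∀ n, IsLOCC (a' n) (b' n) (a n) (b n) (L n)) ∧
    Tendsto (fun n => traceNorm (L n (pureState (ψ n)) - pureState (φ n))) atTop (𝓝 0)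

/-- The maximally entangled state `M^(-1/2) ∑ i, |i⟩ ⊗ |i⟩` of Schmidt rank `M` (for `M ≥ 1`). -/
def maxEntangled (M : ℕ) : BipartiteKet M M :=
  WithLp.toLp 2 fun p => if p.1 = p.2 then (((Real.sqrt M)⁻¹ : ℝ) : ℂ) else 0

/-- `R` is an achievable rate for entanglement dilution to the sequence `φ n`. -/
def DilutionAchievable {a b : ℕ → ℕ} (φ : (n : ℕ) → BipartiteKet (a n) (b n)) (R : ℝ) : Prop :=
  ∃ M : ℕ → ℕ, (∀ n, 1 ≤ M n) ∧
    AsympConvertible (fun n => maxEntangled (M n)) φ ∧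
    limsup (fun n : ℕ => ((1 / (n : ℝ) * Real.log (M n) : ℝ) : EReal)) atTop ≤ (R : EReal)

/-- The entanglement dilution rate (entanglement cost): the infimum of the achievable rates, as an
extended real number (`⊤` if no rate is achievable). -/
def dilutionRate {a b : ℕ → ℕ} (φ : (n : ℕ) → BipartiteKet (a n) (b n)) : EReal :=
  sInf (Real.toEReal '' {R : ℝ | DilutionAchievable φ R})

/-- The inf-spectral divergence rate `D̲(ε|ρ‖σ)`, the supremum, in the extended reals, of the real
numbers `α` with `liminf Tr ρₙ {ρₙ - e^(nα) σₙ > 0} ≥ 1 - ε`. -/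
def infSpectralDivergence (ε : ℝ) {d : ℕ → ℕ}
    (ρ σ : (n : ℕ) → Matrix (Fin (d n)) (Fin (d n)) ℂ) : EReal :=
  sSup (Real.toEReal '' {α : ℝ |
    ((1 - ε : ℝ) : EReal) ≤ liminf (fun n : ℕ =>
      (((ρ n * posProj (ρ n - ((Real.exp (n * α) : ℝ) : ℂ) • σ n)).trace.re : ℝ) : EReal)) atTop})

/-- The sup-spectral entropy rate `H̄(ε|ρ) = - D̲(ε|ρ‖I)`. -/
def supSpectralEntropyEps (ε : ℝ) {d : ℕ → ℕ}
    (ρ : (n : ℕ) → Matrix (Fin (d n)) (Fin (d n)) ℂ) : EReal :=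
  -infSpectralDivergence ε ρ (fun _ => 1)

/-- The sup-spectral entropy rate `H̄(ρ) = H̄(0|ρ)`. -/
def supSpectralEntropy {d : ℕ → ℕ} (ρ : (n : ℕ) → Matrix (Fin (d n)) (Fin (d n)) ℂ) : EReal :=
  supSpectralEntropyEps 0 ρ

end

/-! Both inequalities come from one-shot bounds in terms of `spectralWeight φ θ`, the mass that the
spectrum of the reduced state puts above `θ`. The entropy rate is minus the supremum of the `α` for
which this weight at `θ = e^(nα)` tends to `1`.

Direct part (`exists_isLOCC_traceNorm_le`): at most `1/θ` eigenvalues exceed `θ`. Keeping only those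
Schmidt terms of `φ` and renormalising gives `ψ` with `⟨ψ, φ⟩ = √w`, where `w` is the weight. A
maximally entangled state whose rank is the number of terms kept becomes `ψ` exactly under a one-way
protocol (`exists_isLOCC_maxEntangled`).

Converse (`IsLOCC.one_sub_traceNorm_le`): from a pure state of Schmidt rank at most `M`, LOCC yields
a sum of unnormalised pure states of Schmidt rank at most `M`. Their overlap with `φ` is controlled
by the mass of the reduced state on a subspace of dimension at most `M`, hence by `w + M θ`. If `M`
grows more slowly than `1/θ`, a vanishing error forces `w → 1`. -/

/-! ### Quadratic forms, trace norm and functional calculus in an eigenbasis. -/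

section Spectral

variable {ι : Type*} [Fintype ι] {A : Matrix ι ι ℂ}

/-- The quadratic form `⟨x, A x⟩` of a matrix. -/
def quadForm (A : Matrix ι ι ℂ) (x : EuclideanSpace ℂ ι) : ℂ :=
  ∑ r, ∑ s, star (x r) * A r s * x s

theorem quadForm_sub (A B : Matrix ι ι ℂ) (x : EuclideanSpace ℂ ι) :
    quadForm (A - B) x = quadForm A x - quadForm B x := by
  simp [quadForm, mul_sub, sub_mul, Finset.sum_sub_distrib]

theorem quadForm_sum {κ : Type*} (t : Finset κ) (A : κ → Matrix ι ι ℂ) (x : EuclideanSpace ℂ ι) :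
    quadForm (∑ k ∈ t, A k) x = ∑ k ∈ t, quadForm (A k) x := by
  classical
  induction t using Finset.induction_on with
  | empty => simp [quadForm]
  | insert k t hk ih =>
    rw [Finset.sum_insert hk, Finset.sum_insert hk, ← ih]
    simp [quadForm, mul_add, add_mul, Finset.sum_add_distrib]

theorem quadForm_rankOne (y x : EuclideanSpace ℂ ι) :
    quadForm (Matrix.of fun i j => y i * star (y j)) x = ((‖inner ℂ y x‖ ^ 2 : ℝ) : ℂ) := by
  have h : ((‖inner ℂ y x‖ ^ 2 : ℝ) : ℂ) = inner ℂ x y * inner ℂ y x := by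
    rw [← inner_conj_symm x y, ← Complex.normSq_eq_norm_sq, Complex.normSq_eq_conj_mul_self]
  rw [h, quadForm, PiLp.inner_apply, PiLp.inner_apply, Finset.sum_mul_sum]
  refine Finset.sum_congr rfl fun r _ => Finset.sum_congr rfl fun s _ => ?_
  simp only [Matrix.of_apply, RCLike.inner_apply, Complex.star_def]
  ring

variable [DecidableEq ι]

theorem Matrix.IsHermitian.apply_eq_sum (hA : A.IsHermitian) (r s : ι) :
    A r s = ∑ i, (hA.eigenvalues i : ℂ) *
      (hA.eigenvectorBasis i r * star (hA.eigenvectorBasis i s)) := by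
  conv_lhs => rw [hA.spectral_theorem, Unitary.conjStarAlgAut_apply, Matrix.mul_assoc,
    Matrix.mul_apply]
  refine Finset.sum_congr rfl fun i _ => ?_
  simp only [Matrix.diagonal_mul, Matrix.star_apply, Matrix.IsHermitian.eigenvectorUnitary_apply,
    Function.comp_apply, RCLike.ofReal_eq_complex_ofReal]
  simp
  ring

theorem Matrix.IsHermitian.quadForm_eq_sum (hA : A.IsHermitian) (x : EuclideanSpace ℂ ι) :
    quadForm A x =
      ((∑ i, hA.eigenvalues i * ‖inner ℂ (hA.eigenvectorBasis i) x‖ ^ 2 : ℝ) : ℂ) := by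
  have h : A = ∑ i, (hA.eigenvalues i : ℂ) • (Matrix.of fun r s =>
      hA.eigenvectorBasis i r * star (hA.eigenvectorBasis i s)) := by
    ext r s
    rw [Matrix.sum_apply]
    simpa using hA.apply_eq_sum r s
  conv_lhs => rw [h, quadForm_sum]
  push_cast
  refine Finset.sum_congr rfl fun i _ => ?_
  have := quadForm_rankOne (hA.eigenvectorBasis i) x
  push_cast at this
  rw [← this]
  simp only [quadForm, Matrix.smul_apply, Finset.mul_sum, smul_eq_mul]
  refine Finset.sum_congr rfl fun r _ => Finset.sum_congr rfl fun s _ => ?_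
  ring

theorem Matrix.IsHermitian.quadForm_eigenvectorBasis (hA : A.IsHermitian) (i : ι) :
    quadForm A (hA.eigenvectorBasis i) = hA.eigenvalues i := by
  rw [hA.quadForm_eq_sum, Finset.sum_eq_single i]
  · simp
  · intro j _ hj
    simp [hA.eigenvectorBasis.inner_eq_ite, hj]
  · simp

theorem Matrix.IsHermitian.trace_cfc (hA : A.IsHermitian) (f : ℝ → ℝ) :
    (cfc f A).trace = ((∑ i, f (hA.eigenvalues i) : ℝ) : ℂ) := by
  rw [hA.cfc_eq, Matrix.IsHermitian.cfc, Unitary.conjStarAlgAut_apply, Matrix.mul_assoc,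
    Matrix.trace_mul_comm, Matrix.mul_assoc, Unitary.coe_star_mul_self,
    Matrix.mul_one, Matrix.trace_diagonal]
  simp

/-- The spectrum is finite, so even the indicator function in `posProj` is admissible for `cfc`. -/
theorem continuousOn_spectrum (A : Matrix ι ι ℂ) (f : ℝ → ℝ) : ContinuousOn f (spectrum ℝ A) :=
  (Matrix.finite_real_spectrum (A := A)).continuousOn f

theorem traceNorm_eq_sum_abs (hA : A.IsHermitian) :
    traceNorm A = ∑ i, |hA.eigenvalues i| := by
  have hsa : IsSelfAdjoint A := hA
  have h : Aᴴ * A = cfc (fun x : ℝ => x * x) A := by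
    rw [cfc_mul (fun x : ℝ => x) (fun x : ℝ => x) A (continuousOn_spectrum _ _)
      (continuousOn_spectrum _ _), cfc_id' ℝ A, hA.eq]
  rw [traceNorm, h, ← cfc_comp' Real.sqrt (fun x : ℝ => x * x) A
    (((Matrix.finite_real_spectrum (A := A)).image _).continuousOn _)
    (continuousOn_spectrum _ _), hA.trace_cfc, Complex.ofReal_re]
  simp [Real.sqrt_mul_self_eq_abs]

theorem trace_mul_posProj (hA : A.IsHermitian) (θ : ℝ) :
    (A * posProj (A - (θ : ℂ) • (1 : Matrix ι ι ℂ))).trace.re =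
      ∑ i, if θ < hA.eigenvalues i then hA.eigenvalues i else 0 := by
  have hsa : IsSelfAdjoint A := hA
  have h : A - (θ : ℂ) • (1 : Matrix ι ι ℂ) = cfc (fun x : ℝ => x - θ) A := by
    rw [cfc_sub (fun x : ℝ => x) (fun _ : ℝ => θ) A (continuousOn_spectrum _ _)
      (continuousOn_spectrum _ _), cfc_id' ℝ A, cfc_const θ A]
    rw [Algebra.algebraMap_eq_smul_one]
    simp
  rw [posProj, h, ← cfc_comp' _ (fun x : ℝ => x - θ) A
    (((Matrix.finite_real_spectrum (A := A)).image _).continuousOn _)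
    (continuousOn_spectrum _ _)]
  nth_rewrite 1 [← cfc_id' ℝ A]
  rw [← cfc_mul _ _ A (continuousOn_spectrum _ _) (continuousOn_spectrum _ _), hA.trace_cfc,
    Complex.ofReal_re]
  simp

/-- Turns a trace-norm error into a bound on the overlap with the target state. -/
theorem abs_re_quadForm_le (hA : A.IsHermitian) {x : EuclideanSpace ℂ ι} (hx : ‖x‖ = 1) :
    |(quadForm A x).re| ≤ traceNorm A := by
  rw [hA.quadForm_eq_sum, Complex.ofReal_re, traceNorm_eq_sum_abs hA]
  refine (Finset.abs_sum_le_sum_abs _ _).trans (Finset.sum_le_sum fun i _ => ?_)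
  rw [abs_mul, abs_of_nonneg (sq_nonneg ‖_‖)]
  refine mul_le_of_le_one_right (abs_nonneg _) (pow_le_one₀ (norm_nonneg _) ?_)
  refine (norm_inner_le_norm _ _).trans ?_
  simp [hx]

end Spectral

/-! ### Trace distance of pure states. -/

section PureState

variable {a b : ℕ}

theorem quadForm_pureState (ψ x : BipartiteKet a b) :
    quadForm (pureState ψ) x = ((‖inner ℂ ψ x‖ ^ 2 : ℝ) : ℂ) :=
  quadForm_rankOne ψ x

theorem isHermitian_pureState (ψ : BipartiteKet a b) : (pureState ψ).IsHermitian := by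
  ext i j
  simp [pureState, mul_comm]

/-- In an eigenbasis `e` of the difference, each eigenvalue is `|⟨eᵢ, ψ⟩|² - |⟨eᵢ, φ⟩|²`. Factor
this difference of squares and apply Cauchy–Schwarz to each term. -/
theorem traceNorm_pureState_sub_le {ψ φ : BipartiteKet a b} (hψ : ‖ψ‖ = 1) (hφ : ‖φ‖ = 1) :
    traceNorm (pureState ψ - pureState φ) ≤ 2 * ‖ψ - φ‖ := by
  have hA : (pureState ψ - pureState φ).IsHermitian :=
    (isHermitian_pureState ψ).sub (isHermitian_pureState φ)
  set e := hA.eigenvectorBasis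
  have hpars (x : BipartiteKet a b) : ∑ i, ‖inner ℂ (e i) x‖ ^ 2 = ‖x‖ ^ 2 :=
    e.sum_sq_norm_inner_right x
  have cs (x : BipartiteKet a b) (hx : ‖x‖ = 1) :
      ∑ i, ‖inner ℂ (e i) (ψ - φ)‖ * ‖inner ℂ (e i) x‖ ≤ ‖ψ - φ‖ := by
    have := Finset.sum_mul_sq_le_sq_mul_sq Finset.univ (fun i => ‖inner ℂ (e i) (ψ - φ)‖)
      (fun i => ‖inner ℂ (e i) x‖)
    rw [hpars, hpars, hx, one_pow, mul_one] at this
    exact abs_le_of_sq_le_sq' this (norm_nonneg _) |>.2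
  rw [traceNorm_eq_sum_abs hA]
  calc ∑ i, |hA.eigenvalues i|
      ≤ ∑ i, (‖inner ℂ (e i) (ψ - φ)‖ * ‖inner ℂ (e i) ψ‖ +
          ‖inner ℂ (e i) (ψ - φ)‖ * ‖inner ℂ (e i) φ‖) := by
        refine Finset.sum_le_sum fun i _ => ?_
        have h : hA.eigenvalues i = ‖inner ℂ (e i) ψ‖ ^ 2 - ‖inner ℂ (e i) φ‖ ^ 2 := by
          have := hA.quadForm_eigenvectorBasis i
          rw [quadForm_sub, quadForm_pureState, quadForm_pureState, ← Complex.ofReal_sub,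
            Complex.ofReal_inj] at this
          rw [← this, norm_inner_symm ψ, norm_inner_symm φ]
        rw [h, sq_sub_sq, abs_mul, abs_of_nonneg (by positivity), ← mul_add, mul_comm]
        gcongr
        rw [inner_sub_right]
        exact abs_norm_sub_norm_le _ _
    _ ≤ 2 * ‖ψ - φ‖ := by
        rw [Finset.sum_add_distrib]
        linarith [cs ψ hψ, cs φ hφ]

end PureState

/-! ### LOCC acting on pure states and Schmidt rank. -/

section Locc

variable {a b : ℕ}

/-- The coefficient matrix of a bipartite vector. -/
def coeffMatrix (ψ : BipartiteKet a b) : Matrix (Fin a) (Fin b) ℂ :=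
  Matrix.of fun i k => ψ (i, k)

/-- The vector `C ψ`. -/
def applyOp {c d : ℕ} (C : Matrix (Fin c × Fin d) (Fin a × Fin b) ℂ) (ψ : BipartiteKet a b) :
    BipartiteKet c d :=
  WithLp.toLp 2 (C *ᵥ ψ.ofLp)

/-- Lets each branch of a protocol be followed as an unnormalised vector. -/
theorem conj_pureState {c d : ℕ} (C : Matrix (Fin c × Fin d) (Fin a × Fin b) ℂ)
    (ψ : BipartiteKet a b) : C * pureState ψ * Cᴴ = pureState (applyOp C ψ) := by
  have h : ∀ {c d : ℕ} (χ : BipartiteKet c d),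
      pureState χ = Matrix.vecMulVec χ.ofLp (star χ.ofLp) := fun _ => rfl
  rw [h, h, Matrix.mul_vecMulVec, Matrix.vecMulVec_mul, ← Matrix.star_mulVec]
  rfl

theorem norm_sq_applyOp {c d : ℕ} (C : Matrix (Fin c × Fin d) (Fin a × Fin b) ℂ)
    (ψ : BipartiteKet a b) : ((‖applyOp C ψ‖ ^ 2 : ℝ) : ℂ) = quadForm (Cᴴ * C) ψ := by
  have h : quadForm (Cᴴ * C) ψ = star ψ.ofLp ⬝ᵥ ((Cᴴ * C) *ᵥ ψ.ofLp) := by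
    simp only [quadForm, dotProduct, Matrix.mulVec, Finset.mul_sum, mul_assoc, Pi.star_apply]
  rw [h, ← Matrix.mulVec_mulVec, Matrix.dotProduct_mulVec, ← Matrix.star_mulVec]
  have := inner_self_eq_norm_sq_to_K (𝕜 := ℂ) (applyOp C ψ)
  rw [EuclideanSpace.inner_eq_star_dotProduct, dotProduct_comm] at this
  push_cast
  exact this.symm

theorem quadForm_one (ψ : BipartiteKet a b) : quadForm 1 ψ = ((‖ψ‖ ^ 2 : ℝ) : ℂ) := by
  have := norm_sq_applyOp (1 : BipartiteOp a b) ψ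
  simpa [applyOp] using this.symm

theorem sum_norm_sq_applyOp {k : ℕ} {c d : Fin k → ℕ}
    (C : (x : Fin k) → Matrix (Fin (c x) × Fin (d x)) (Fin a × Fin b) ℂ)
    (hC : ∑ x, (C x)ᴴ * C x = 1) (ψ : BipartiteKet a b) :
    ∑ x, ‖applyOp (C x) ψ‖ ^ 2 = ‖ψ‖ ^ 2 := by
  have h : ((∑ x, ‖applyOp (C x) ψ‖ ^ 2 : ℝ) : ℂ) = ((‖ψ‖ ^ 2 : ℝ) : ℂ) := by
    rw [Complex.ofReal_sum, ← quadForm_one, ← hC, quadForm_sum]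
    exact Finset.sum_congr rfl fun x _ => norm_sq_applyOp _ _
  exact_mod_cast h

theorem sum_kronecker_one {k : ℕ} {c : Fin k → ℕ} (K : (x : Fin k) → Matrix (Fin (c x)) (Fin a) ℂ)
    (hK : ∑ x, (K x)ᴴ * K x = 1) :
    ∑ x, (K x ⊗ₖ (1 : Matrix (Fin b) (Fin b) ℂ))ᴴ * (K x ⊗ₖ (1 : Matrix (Fin b) (Fin b) ℂ)) =
      1 := by
  simp only [Matrix.conjTranspose_kronecker, ← Matrix.mul_kronecker_mul, Matrix.conjTranspose_one,
    Matrix.one_mul]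
  rw [← Matrix.one_kronecker_one, ← hK]
  ext i j
  simp [Matrix.sum_apply, Finset.sum_mul]

theorem sum_one_kronecker {k : ℕ} {c : Fin k → ℕ} (K : (x : Fin k) → Matrix (Fin (c x)) (Fin b) ℂ)
    (hK : ∑ x, (K x)ᴴ * K x = 1) :
    ∑ x, ((1 : Matrix (Fin a) (Fin a) ℂ) ⊗ₖ K x)ᴴ * ((1 : Matrix (Fin a) (Fin a) ℂ) ⊗ₖ K x) =
      1 := by
  simp only [Matrix.conjTranspose_kronecker, ← Matrix.mul_kronecker_mul, Matrix.conjTranspose_one,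
    Matrix.one_mul]
  rw [← Matrix.one_kronecker_one, ← hK]
  ext i j
  simp [Matrix.sum_apply, Finset.mul_sum]

theorem coeffMatrix_kronecker_one {c : ℕ} (K : Matrix (Fin c) (Fin a) ℂ) (ψ : BipartiteKet a b) :
    coeffMatrix (applyOp (K ⊗ₖ (1 : Matrix (Fin b) (Fin b) ℂ)) ψ) = K * coeffMatrix ψ := by
  ext i k
  simp [coeffMatrix, applyOp, Matrix.mulVec, dotProduct, Matrix.mul_apply, Fintype.sum_prod_type,
    Matrix.one_apply]

theorem coeffMatrix_one_kronecker {c : ℕ} (K : Matrix (Fin c) (Fin b) ℂ) (ψ : BipartiteKet a b) :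
    coeffMatrix (applyOp ((1 : Matrix (Fin a) (Fin a) ℂ) ⊗ₖ K) ψ) = coeffMatrix ψ * Kᵀ := by
  ext i k
  simp [coeffMatrix, applyOp, Matrix.mulVec, dotProduct, Matrix.mul_apply, Fintype.sum_prod_type,
    Matrix.one_apply, mul_comm]

/-- Induction on the protocol: a local Kraus operator multiplies the coefficient matrix on one side,
so the rank does not grow, and the squared norms of the branches add up to that of the input. The
bound is homogeneous in `χ` because branches are unnormalised. -/
theorem IsLOCC.quadForm_pureState_le {a' b' M : ℕ} {φ : BipartiteKet a' b'} {s : ℝ}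
    (hs : ∀ χ : BipartiteKet a' b', (coeffMatrix χ).rank ≤ M → ‖inner ℂ χ φ‖ ^ 2 ≤ ‖χ‖ ^ 2 * s)
    {L : BipartiteOp a b → BipartiteOp a' b'} (hL : IsLOCC a' b' a b L)
    (χ : BipartiteKet a b) (hχ : (coeffMatrix χ).rank ≤ M) :
    (L (pureState χ)).IsHermitian ∧ (quadForm (L (pureState χ)) φ).re ≤ ‖χ‖ ^ 2 * s := by
  induction hL with
  | done =>
    refine ⟨isHermitian_pureState χ, ?_⟩
    rw [quadForm_pureState, Complex.ofReal_re]
    exact hs χ hχ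
  | alice K hK L hL ih =>
    have hr (x) := ih x (applyOp (K x ⊗ₖ 1) χ) (by
      rw [coeffMatrix_kronecker_one]
      exact (Matrix.rank_mul_le_right _ _).trans hχ)
    simp only [conj_pureState]
    constructor
    · rw [Matrix.IsHermitian, Matrix.conjTranspose_sum]
      exact Finset.sum_congr rfl fun x _ => (hr x).1
    · rw [quadForm_sum, Complex.re_sum, ← sum_norm_sq_applyOp _ (sum_kronecker_one K hK) χ,
        Finset.sum_mul]
      exact Finset.sum_le_sum fun x _ => (hr x).2
  | bob K hK L hL ih =>
    have hr (x) := ih x (applyOp (1 ⊗ₖ K x) χ) (by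
      rw [coeffMatrix_one_kronecker]
      exact (Matrix.rank_mul_le_left _ _).trans hχ)
    simp only [conj_pureState]
    constructor
    · rw [Matrix.IsHermitian, Matrix.conjTranspose_sum]
      exact Finset.sum_congr rfl fun x _ => (hr x).1
    · rw [quadForm_sum, Complex.re_sum, ← sum_norm_sq_applyOp _ (sum_one_kronecker K hK) χ,
        Finset.sum_mul]
      exact Finset.sum_le_sum fun x _ => (hr x).2

end Locc

/-! ### Overlap with vectors of bounded Schmidt rank; the one-shot converse. -/

section Overlap

variable {a b : ℕ}

/-- The `k`-th column of the coefficient matrix of a bipartite vector. -/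
def coeffCol (ψ : BipartiteKet a b) (k : Fin b) : EuclideanSpace ℂ (Fin a) :=
  WithLp.toLp 2 fun i => ψ (i, k)

theorem isHermitian_traceB (φ : BipartiteKet a b) : (traceB (pureState φ)).IsHermitian := by
  ext i j
  simp [traceB, pureState, mul_comm]

theorem quadForm_traceB (φ : BipartiteKet a b) (x : EuclideanSpace ℂ (Fin a)) :
    quadForm (traceB (pureState φ)) x = ((∑ k, ‖inner ℂ (coeffCol φ k) x‖ ^ 2 : ℝ) : ℂ) := by
  have h : traceB (pureState φ) =
      ∑ k, Matrix.of fun i j => coeffCol φ k i * star (coeffCol φ k j) := by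
    ext i j
    simp [traceB, pureState, coeffCol, Matrix.sum_apply]
  rw [h, quadForm_sum, Complex.ofReal_sum]
  exact Finset.sum_congr rfl fun k _ => quadForm_rankOne _ _

theorem inner_eq_sum_coeffCol (χ φ : BipartiteKet a b) :
    inner ℂ χ φ = ∑ k, inner ℂ (coeffCol χ k) (coeffCol φ k) := by
  simp only [PiLp.inner_apply, coeffCol]
  rw [Fintype.sum_prod_type_right]

theorem norm_sq_eq_sum_coeffCol (χ : BipartiteKet a b) :
    ‖χ‖ ^ 2 = ∑ k, ‖coeffCol χ k‖ ^ 2 := by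
  simp only [EuclideanSpace.norm_sq_eq, coeffCol]
  rw [Fintype.sum_prod_type_right]

theorem eigenvalues_traceB_nonneg (φ : BipartiteKet a b) (i : Fin a) :
    0 ≤ (isHermitian_traceB φ).eigenvalues i := by
  have h := (isHermitian_traceB φ).quadForm_eigenvectorBasis i
  rw [quadForm_traceB, Complex.ofReal_inj] at h
  rw [← h]
  positivity

theorem sum_eigenvalues_traceB (φ : BipartiteKet a b) :
    ∑ i, (isHermitian_traceB φ).eigenvalues i = ‖φ‖ ^ 2 := by
  have h (i) := (isHermitian_traceB φ).quadForm_eigenvectorBasis i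
  simp only [quadForm_traceB, Complex.ofReal_inj] at h
  simp only [← h]
  rw [Finset.sum_comm, norm_sq_eq_sum_coeffCol]
  exact Finset.sum_congr rfl fun k _ =>
    (isHermitian_traceB φ).eigenvectorBasis.sum_sq_norm_inner_left _

/-- The total weight of the eigenvalues exceeding `θ` of the reduced state of `φ`. -/
noncomputable def spectralWeight (φ : BipartiteKet a b) (θ : ℝ) : ℝ :=
  ∑ i, if θ < (isHermitian_traceB φ).eigenvalues i then (isHermitian_traceB φ).eigenvalues i else 0

/-- A vector of Schmidt rank at most `M` has a small overlap with `φ` if the reduced state of `φ`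
has few large eigenvalues. -/
theorem norm_inner_sq_le_of_rank_le (φ χ : BipartiteKet a b) {M : ℕ}
    (hχ : (coeffMatrix χ).rank ≤ M) {θ : ℝ} (hθ : 0 ≤ θ) :
    ‖inner ℂ χ φ‖ ^ 2 ≤ ‖χ‖ ^ 2 * (spectralWeight φ θ + M * θ) := by
  -- `W` is the column span of `χ`; only the projections of the columns of `φ` to `W` contribute to
  -- the overlap.
  set W : Submodule ℂ (EuclideanSpace ℂ (Fin a)) :=
    LinearMap.range (Matrix.toLpLin 2 2 (coeffMatrix χ)) with hW
  have hdim : Module.finrank ℂ W ≤ M := by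
    refine le_trans (le_of_eq ?_) hχ
    rw [Matrix.rank_eq_finrank_range_toLin (coeffMatrix χ)
      (PiLp.basisFun 2 ℂ (Fin a)) (PiLp.basisFun 2 ℂ (Fin b)), hW, Matrix.toLpLin_eq_toLin]
  have hmem (k) : coeffCol χ k ∈ W := by
    refine ⟨EuclideanSpace.single k 1, ?_⟩
    ext i
    simp [coeffCol, coeffMatrix, Matrix.toLpLin]
  set f := stdOrthonormalBasis ℂ W
  set hρ := isHermitian_traceB φ
  have hproj (x : EuclideanSpace ℂ (Fin a)) :
      ‖W.orthogonalProjectionOnto x‖ ^ 2 = ∑ j, ‖inner ℂ x (f j : EuclideanSpace ℂ (Fin a))‖ ^ 2 := by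
    rw [← f.sum_sq_norm_inner_left]
    refine Finset.sum_congr rfl fun j _ => ?_
    rw [norm_inner_symm, norm_inner_symm x, Submodule.inner_orthogonalProjectionOnto_eq_of_mem_left]
  have hinner (k) : ‖inner ℂ (coeffCol χ k) (coeffCol φ k)‖ ≤
      ‖coeffCol χ k‖ * ‖W.orthogonalProjectionOnto (coeffCol φ k)‖ := by
    have h := Submodule.inner_orthogonalProjectionOnto_eq_of_mem_left ⟨_, hmem k⟩ (coeffCol φ k)
    rw [← h]
    exact norm_inner_le_norm _ _
  have hweight : ∑ k, ‖W.orthogonalProjectionOnto (coeffCol φ k)‖ ^ 2 ≤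
      spectralWeight φ θ + M * θ := by
    -- Both sides are `Tr (P ρ)`, with `P` the projection onto `W` and `ρ` the reduced state of `φ`.
    have h1 : ∑ k, ‖W.orthogonalProjectionOnto (coeffCol φ k)‖ ^ 2 =
        ∑ i, hρ.eigenvalues i * ‖W.orthogonalProjectionOnto (hρ.eigenvectorBasis i)‖ ^ 2 := by
      simp only [hproj, Finset.mul_sum]
      rw [Finset.sum_comm, Finset.sum_comm (s := (Finset.univ : Finset (Fin a)))]
      refine Finset.sum_congr rfl fun j _ => ?_
      have := hρ.quadForm_eq_sum (f j)
      rwa [quadForm_traceB, Complex.ofReal_inj] at this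
    have h2 : ∑ i, ‖W.orthogonalProjectionOnto (hρ.eigenvectorBasis i)‖ ^ 2 ≤ M := by
      simp only [hproj]
      rw [Finset.sum_comm]
      simp only [hρ.eigenvectorBasis.sum_sq_norm_inner_right]
      simp only [Submodule.norm_coe, OrthonormalBasis.norm_eq_one]
      simpa using hdim
    rw [h1]
    -- Eigenvalues above `θ` are counted in full; the others are at most `θ`, and the squared
    -- projections sum to at most `M`.
    calc _ ≤ ∑ i, ((if θ < hρ.eigenvalues i then hρ.eigenvalues i else 0) +
          θ * ‖W.orthogonalProjectionOnto (hρ.eigenvectorBasis i)‖ ^ 2) := by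
          refine Finset.sum_le_sum fun i _ => ?_
          have hq : ‖W.orthogonalProjectionOnto (hρ.eigenvectorBasis i)‖ ^ 2 ≤ 1 := by
            refine pow_le_one₀ (norm_nonneg _) ?_
            refine (W.norm_orthogonalProjectionOnto_apply_le _).trans ?_
            simp
          have h0 := eigenvalues_traceB_nonneg φ i
          split_ifs with h
          · have := mul_le_of_le_one_right h0 hq
            have : 0 ≤ θ * ‖W.orthogonalProjectionOnto (hρ.eigenvectorBasis i)‖ ^ 2 := by positivity
            linarith
          · rw [zero_add]
            gcongr
            exact not_lt.mp h
      _ ≤ _ := by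
          rw [Finset.sum_add_distrib, ← Finset.mul_sum, mul_comm (M : ℝ)]
          gcongr
          exact le_rfl
  rw [inner_eq_sum_coeffCol]
  calc ‖∑ k, inner ℂ (coeffCol χ k) (coeffCol φ k)‖ ^ 2
      ≤ (∑ k, ‖coeffCol χ k‖ * ‖W.orthogonalProjectionOnto (coeffCol φ k)‖) ^ 2 := by
        gcongr
        exact (norm_sum_le _ _).trans (Finset.sum_le_sum fun k _ => hinner k)
    _ ≤ (∑ k, ‖coeffCol χ k‖ ^ 2) * ∑ k, ‖W.orthogonalProjectionOnto (coeffCol φ k)‖ ^ 2 :=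
        Finset.sum_mul_sq_le_sq_mul_sq _ _ _
    _ ≤ _ := by
        rw [norm_sq_eq_sum_coeffCol]
        gcongr

theorem norm_maxEntangled {M : ℕ} (hM : 1 ≤ M) : ‖maxEntangled M‖ = 1 := by
  have hM' : (0 : ℝ) < M := by exact_mod_cast hM
  have h : ‖maxEntangled M‖ ^ 2 = 1 := by
    rw [EuclideanSpace.norm_sq_eq, Fintype.sum_prod_type]
    have (i j : Fin M) : ‖maxEntangled M (i, j)‖ ^ 2 = if i = j then (M : ℝ)⁻¹ else 0 := by
      by_cases h : i = j <;> simp [maxEntangled, h, hM'.le]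
    simp [this, hM'.ne']
  nlinarith [norm_nonneg (maxEntangled M)]

/-- Converse bound for a single LOCC conversion of a maximally entangled state. -/
theorem IsLOCC.one_sub_traceNorm_le {M : ℕ} (hM : 1 ≤ M) {φ : BipartiteKet a b} (hφ : ‖φ‖ = 1)
    {L : BipartiteOp M M → BipartiteOp a b} (hL : IsLOCC a b M M L) {θ : ℝ} (hθ : 0 ≤ θ) :
    1 - traceNorm (L (pureState (maxEntangled M)) - pureState φ) ≤
      spectralWeight φ θ + M * θ := by
  obtain ⟨h1, h2⟩ := hL.quadForm_pureState_le
    (M := M) (fun χ hχ => norm_inner_sq_le_of_rank_le φ χ hχ hθ) (maxEntangled M)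
    ((Matrix.rank_le_card_width _).trans (by simp))
  have h3 := (abs_le.mp (abs_re_quadForm_le (h1.sub (isHermitian_pureState φ)) hφ)).1
  have h4 : quadForm (pureState φ) φ = 1 := by
    rw [quadForm_pureState]
    simp [hφ]
  rw [norm_maxEntangled hM, one_pow, one_mul] at h2
  rw [quadForm_sub, h4, Complex.sub_re, Complex.one_re] at h3
  linarith

end Overlap

/-! ### The dilution protocol and the one-shot direct bound. -/

section Dilution

variable {a b : ℕ}

theorem coeffMatrix_maxEntangled (M : ℕ) :
    coeffMatrix (maxEntangled M) = (((Real.sqrt M)⁻¹ : ℝ) : ℂ) • (1 : Matrix (Fin M) (Fin M) ℂ) := by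
  ext i j
  simp [coeffMatrix, maxEntangled, Matrix.one_apply]

theorem pureState_smul (c : ℝ) (ψ : BipartiteKet a b) :
    pureState ((c : ℂ) • ψ) = ((c ^ 2 : ℝ) : ℂ) • pureState ψ := by
  ext i j
  simp [pureState]
  ring

/-- A one-way LOCC protocol turning a maximally entangled state into a state with prescribed
Schmidt decomposition of the same rank. -/
theorem exists_isLOCC_maxEntangled {M : ℕ} [NeZero M] {u : Fin M → EuclideanSpace ℂ (Fin a)}
    {v : Fin M → EuclideanSpace ℂ (Fin b)} (hu : Orthonormal ℂ u) (hv : Orthonormal ℂ v)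
    {p : Fin M → ℝ} (hp : ∀ j, 0 ≤ p j) (hp1 : ∑ j, p j = 1) {ψ : BipartiteKet a b}
    (hψ : ∀ r s, ψ (r, s) = ∑ j, ((Real.sqrt (p j) : ℝ) : ℂ) * u j r * v j s) :
    ∃ L, IsLOCC a b M M L ∧ L (pureState (maxEntangled M)) = pureState ψ := by
  have hin {d : ℕ} {w : Fin M → EuclideanSpace ℂ (Fin d)} (hw : Orthonormal ℂ w) (i j : Fin M) :
      ∑ r, star (w i r) * w j r = if i = j then 1 else 0 := by
    rw [← orthonormal_iff_ite.mp hw i j, PiLp.inner_apply]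
    exact Finset.sum_congr rfl fun r _ => by simp [mul_comm]
  -- Outcome `x` shifts the Schmidt indices cyclically. The sum over all shifts makes the
  -- measurement complete, as `∑ x, p (i + x) = 1`; Bob's isometry `V x` applies the same shift, so
  -- every outcome leaves `ψ / √M`.
  let K : Fin M → Matrix (Fin a) (Fin M) ℂ := fun x =>
    Matrix.of fun r j => ((Real.sqrt (p (j + x)) : ℝ) : ℂ) * u (j + x) r
  let V : Fin M → Matrix (Fin b) (Fin M) ℂ := fun x => Matrix.of fun s j => v (j + x) s
  have hK : ∑ x, (K x)ᴴ * K x = 1 := by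
    ext i j
    have h (x : Fin M) : ((K x)ᴴ * K x) i j = if i = j then ((p (i + x) : ℝ) : ℂ) else 0 := by
      calc ((K x)ᴴ * K x) i j = ((Real.sqrt (p (i + x)) : ℝ) : ℂ) *
            ((Real.sqrt (p (j + x)) : ℝ) : ℂ) * ∑ r, star (u (i + x) r) * u (j + x) r := by
            rw [Matrix.mul_apply, Finset.mul_sum]
            refine Finset.sum_congr rfl fun r _ => ?_
            simp [K]
            ring
        _ = _ := by
            rw [hin hu]
            by_cases hij : i = j
            · subst hij
              simp only [if_true, mul_one]
              rw [← Complex.ofReal_mul, Real.mul_self_sqrt (hp _)]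
            · simp [hij]
    rw [Matrix.sum_apply, Finset.sum_congr rfl fun x _ => h x, Matrix.one_apply]
    split_ifs
    · rw [← Complex.ofReal_sum, ← Complex.ofReal_one, ← hp1]
      exact congrArg _ (Equiv.sum_comp (Equiv.addLeft i) p)
    · simp
  have hV (x : Fin M) : (V x)ᴴ * V x = 1 := by
    ext i j
    rw [Matrix.mul_apply, Matrix.one_apply]
    have := hin hv (i + x) (j + x)
    simpa [V] using this
  refine ⟨_, IsLOCC.alice K hK _ fun x => IsLOCC.bob (k := 1) (c := fun _ => b) (fun _ => V x)
    (by simpa using hV x) (fun _ ρ => ρ) fun _ => IsLOCC.done, ?_⟩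
  have hout (x : Fin M) : applyOp ((1 : Matrix (Fin a) (Fin a) ℂ) ⊗ₖ V x)
      (applyOp (K x ⊗ₖ (1 : Matrix (Fin M) (Fin M) ℂ)) (maxEntangled M)) =
        (((Real.sqrt M)⁻¹ : ℝ) : ℂ) • ψ := by
    have h := coeffMatrix_one_kronecker (V x)
      (applyOp (K x ⊗ₖ (1 : Matrix (Fin M) (Fin M) ℂ)) (maxEntangled M))
    rw [coeffMatrix_kronecker_one, coeffMatrix_maxEntangled] at h
    ext ⟨r, s⟩
    have h' := congrFun (congrFun h r) s
    refine (show _ = _ from h').trans ?_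
    rw [Matrix.mul_smul, Matrix.mul_one, Matrix.smul_mul, Matrix.smul_apply, PiLp.smul_apply, hψ,
      Matrix.mul_apply]
    congr 1
    exact Equiv.sum_comp (Equiv.addRight x) fun j => ((Real.sqrt (p j) : ℝ) : ℂ) * u j r * v j s
  have hM : (M : ℝ) ≠ 0 := by exact_mod_cast NeZero.ne M
  simp only [conj_pureState, Finset.univ_unique, Finset.sum_singleton, hout, pureState_smul]
  rw [Finset.sum_const, Finset.card_univ, Fintype.card_fin, inv_pow, Real.sq_sqrt (by positivity),
    ← Nat.cast_smul_eq_nsmul ℂ, smul_smul]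
  rw [← Complex.ofReal_natCast, ← Complex.ofReal_mul, mul_inv_cancel₀ hM, Complex.ofReal_one,
    one_smul]

/-- The sum is `⟨eⱼ, ρ eᵢ⟩` for the reduced state `ρ`. This is the orthogonality of the B-side
vectors in the Schmidt decomposition. -/
theorem sum_inner_coeffCol (φ : BipartiteKet a b) (i j : Fin a) :
    ∑ s, star (inner ℂ ((isHermitian_traceB φ).eigenvectorBasis i) (coeffCol φ s)) *
      inner ℂ ((isHermitian_traceB φ).eigenvectorBasis j) (coeffCol φ s) =
        if i = j then (((isHermitian_traceB φ).eigenvalues i : ℝ) : ℂ) else 0 := by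
  set hρ := isHermitian_traceB φ
  set e := hρ.eigenvectorBasis
  have h1 := hρ.mulVec_eigenvectorBasis i
  calc _ = star (e j).ofLp ⬝ᵥ (traceB (pureState φ) *ᵥ (e i).ofLp) := by
        simp only [dotProduct, Matrix.mulVec, PiLp.inner_apply, traceB, pureState, coeffCol,
          Matrix.of_apply, Finset.sum_mul, Finset.mul_sum, star_sum]
        rw [Finset.sum_comm]
        refine Finset.sum_congr rfl fun r _ => ?_
        rw [Finset.sum_comm]
        refine Finset.sum_congr rfl fun r' _ => ?_
        refine Finset.sum_congr rfl fun s _ => ?_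
        simp
        ring
    _ = (hρ.eigenvalues i : ℂ) * inner ℂ (e j) (e i) := by
        rw [h1, dotProduct_smul, EuclideanSpace.inner_eq_star_dotProduct, dotProduct_comm]
        simp [e]
    _ = _ := by
        rw [e.inner_eq_ite]
        by_cases h : i = j
        · simp [h]
        · simp [h, Ne.symm h]

/-- Direct bound for a single LOCC conversion of a maximally entangled state. -/
theorem exists_isLOCC_traceNorm_le {φ : BipartiteKet a b} (hφ : ‖φ‖ = 1) {θ : ℝ} (hθ : 0 ≤ θ)
    (ht : 0 < spectralWeight φ θ) :
    ∃ M : ℕ, 1 ≤ M ∧ M * θ ≤ 1 ∧ ∃ L, IsLOCC a b M M L ∧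
      traceNorm (L (pureState (maxEntangled M)) - pureState φ) ≤
        2 * Real.sqrt (2 - 2 * Real.sqrt (spectralWeight φ θ)) := by
  set t := spectralWeight φ θ with ht_def
  set hρ := isHermitian_traceB φ with hρ_def
  set S : Finset (Fin a) := Finset.univ.filter fun i => θ < hρ.eigenvalues i with hS
  have htS : ∑ i ∈ S, hρ.eigenvalues i = t := by
    rw [hS, Finset.sum_filter]
    rfl
  have hne : S.Nonempty := by
    rw [Finset.nonempty_iff_ne_empty]
    rintro h
    rw [h, Finset.sum_empty] at htS
    exact ht.ne htS
  have hcard : S.card * θ ≤ 1 := by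
    calc (S.card : ℝ) * θ = ∑ i ∈ S, θ := by simp
      _ ≤ ∑ i ∈ S, hρ.eigenvalues i :=
        Finset.sum_le_sum fun i hi => (Finset.mem_filter.mp hi).2.le
      _ ≤ ∑ i, hρ.eigenvalues i := Finset.sum_le_sum_of_subset_of_nonneg (Finset.subset_univ _)
        fun i _ _ => eigenvalues_traceB_nonneg φ i
      _ = 1 := by rw [sum_eigenvalues_traceB, hφ, one_pow]
  have : NeZero S.card := ⟨hne.card_pos.ne'⟩
  set e : Fin S.card ≃ S := S.equivFin.symm
  set u : Fin S.card → EuclideanSpace ℂ (Fin a) := fun j => hρ.eigenvectorBasis (e j)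
  set l : Fin S.card → ℝ := fun j => hρ.eigenvalues (e j)
  have hl (j) : 0 < l j := hθ.trans_lt (Finset.mem_filter.mp (e j).2).2
  have hlt : ∑ j, l j = t := by
    rw [← htS, e.sum_comp fun i : S => hρ.eigenvalues i, Finset.sum_coe_sort]
  have hu : Orthonormal ℂ u := hρ.eigenvectorBasis.orthonormal.comp _
    (Subtype.val_injective.comp e.injective)
  set c : Fin S.card → Fin b → ℂ := fun j s => inner ℂ (u j) (coeffCol φ s)
  have hc (i j) : ∑ s, star (c i s) * c j s = if i = j then ((l i : ℝ) : ℂ) else 0 := by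
    refine (sum_inner_coeffCol φ (e i) (e j)).trans ?_
    simp only [Subtype.val_inj, EmbeddingLike.apply_eq_iff_eq]
    rfl
  -- The Schmidt vectors on the B side; dividing by `√(l j)` is legitimate since `l j > θ ≥ 0`.
  set v : Fin S.card → EuclideanSpace ℂ (Fin b) := fun j =>
    WithLp.toLp 2 fun s => (((Real.sqrt (l j))⁻¹ : ℝ) : ℂ) * c j s
  have hv : Orthonormal ℂ v := by
    rw [orthonormal_iff_ite]
    intro i j
    calc inner ℂ (v i) (v j) = (((Real.sqrt (l i))⁻¹ : ℝ) : ℂ) * (((Real.sqrt (l j))⁻¹ : ℝ) : ℂ) *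
          ∑ s, star (c i s) * c j s := by
          rw [PiLp.inner_apply, Finset.mul_sum]
          refine Finset.sum_congr rfl fun s _ => ?_
          simp [v]
          ring
      _ = _ := by
          rw [hc]
          split_ifs with h
          · subst h
            rw [← Complex.ofReal_mul, ← Complex.ofReal_mul, ← mul_inv,
              Real.mul_self_sqrt (hl i).le, inv_mul_cancel₀ (hl i).ne', Complex.ofReal_one]
          · simp
  -- The projection of `φ` to the retained Schmidt terms, normalised; then `‖ψ - φ‖² = 2 - 2√t`.
  set ψ : BipartiteKet a b := WithLp.toLp 2 fun q =>
    (((Real.sqrt t)⁻¹ : ℝ) : ℂ) * ∑ j, c j q.2 * u j q.1 with hψ_def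
  have hψ (r s) : ψ (r, s) =
      ∑ j, ((Real.sqrt (l j / t) : ℝ) : ℂ) * u j r * v j s := by
    simp only [hψ_def, Finset.mul_sum]
    refine Finset.sum_congr rfl fun j _ => ?_
    have h1 : Real.sqrt (l j / t) * (Real.sqrt (l j))⁻¹ = (Real.sqrt t)⁻¹ := by
      rw [Real.sqrt_div (hl j).le]
      have := (Real.sqrt_pos.mpr (hl j)).ne'
      field_simp
    rw [← h1]
    simp only [v]
    push_cast
    ring
  have hψcol (s) : coeffCol ψ s = (((Real.sqrt t)⁻¹ : ℝ) : ℂ) • ∑ j, c j s • u j := by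
    ext r
    simp [coeffCol, hψ_def]
  have hcsum : ∑ s, ∑ j, star (c j s) * c j s = ((t : ℝ) : ℂ) := by
    rw [Finset.sum_comm, ← hlt, Complex.ofReal_sum]
    exact Finset.sum_congr rfl fun j _ => by rw [hc, if_pos rfl]
  have hsq : Real.sqrt t * Real.sqrt t = t := Real.mul_self_sqrt ht.le
  have hst : Real.sqrt t ≠ 0 := (Real.sqrt_pos.mpr ht).ne'
  have hψφ : inner ℂ ψ φ = ((Real.sqrt t : ℝ) : ℂ) := by
    rw [inner_eq_sum_coeffCol]
    have h (s) : inner ℂ (coeffCol ψ s) (coeffCol φ s) =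
        (((Real.sqrt t)⁻¹ : ℝ) : ℂ) * ∑ j, star (c j s) * c j s := by
      rw [hψcol, inner_smul_left, sum_inner, Complex.conj_ofReal]
      simp only [inner_smul_left]
      rfl
    rw [Finset.sum_congr rfl fun s _ => h s, ← Finset.mul_sum, hcsum, ← Complex.ofReal_mul]
    congr 1
    field_simp
    linarith
  have hψψ : ‖ψ‖ = 1 := by
    have h0 : inner ℂ ψ ψ = (1 : ℂ) := by
      rw [inner_eq_sum_coeffCol]
      have h (s) : inner ℂ (coeffCol ψ s) (coeffCol ψ s) = (((Real.sqrt t)⁻¹ : ℝ) : ℂ) *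
          ((((Real.sqrt t)⁻¹ : ℝ) : ℂ) * ∑ j, star (c j s) * c j s) := by
        rw [hψcol, inner_smul_left, inner_smul_right, hu.inner_sum, Complex.conj_ofReal]
        rfl
      rw [Finset.sum_congr rfl fun s _ => h s, ← Finset.mul_sum, ← Finset.mul_sum, hcsum,
        ← Complex.ofReal_mul, ← Complex.ofReal_mul, ← Complex.ofReal_one]
      congr 1
      field_simp
      linarith
    rw [@norm_eq_sqrt_re_inner ℂ, h0]
    simp
  refine ⟨S.card, hne.card_pos, hcard, ?_⟩
  obtain ⟨L, hL, hLψ⟩ := exists_isLOCC_maxEntangled hu hv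
    (fun j => div_nonneg (hl j).le ht.le)
    (by rw [← Finset.sum_div, hlt, div_self ht.ne']) hψ
  refine ⟨L, hL, ?_⟩
  rw [hLψ]
  refine (traceNorm_pureState_sub_le hψψ hφ).trans ?_
  gcongr
  refine Real.le_sqrt_of_sq_le (le_of_eq ?_)
  rw [@norm_sub_sq ℂ, hψψ, hφ, hψφ]
  simp
  ring

theorem spectralWeight_zero {φ : BipartiteKet a b} (hφ : ‖φ‖ = 1) : spectralWeight φ 0 = 1 := by
  rw [← one_pow 2, ← hφ, ← sum_eigenvalues_traceB]
  refine Finset.sum_congr rfl fun i _ => ?_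
  have := eigenvalues_traceB_nonneg φ i
  split_ifs with h
  · rfl
  · exact le_antisymm this (not_lt.mp h)

theorem spectralWeight_le_one {φ : BipartiteKet a b} (hφ : ‖φ‖ = 1) (θ : ℝ) :
    spectralWeight φ θ ≤ 1 := by
  rw [← one_pow 2, ← hφ, ← sum_eigenvalues_traceB]
  refine Finset.sum_le_sum fun i _ => ?_
  have := eigenvalues_traceB_nonneg φ i
  split_ifs <;> simp [this]

end Dilution

/-! ### From one-shot bounds to asymptotic rates. -/

section Rates

variable {dA dB : ℕ → ℕ} {φ : (n : ℕ) → BipartiteKet (dA n) (dB n)}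

theorem supSpectralEntropy_traceB (φ : (n : ℕ) → BipartiteKet (dA n) (dB n)) :
    supSpectralEntropy (fun n => traceB (pureState (φ n))) =
      -sSup (Real.toEReal '' {α : ℝ | (1 : EReal) ≤
        liminf (fun n : ℕ => ((spectralWeight (φ n) (Real.exp (n * α)) : ℝ) : EReal)) atTop}) := by
  have h (α : ℝ) (n : ℕ) : ((traceB (pureState (φ n))) * posProj (traceB (pureState (φ n)) -
      ((Real.exp (n * α) : ℝ) : ℂ) • (1 : Matrix (Fin (dA n)) (Fin (dA n)) ℂ))).trace.re =
        spectralWeight (φ n) (Real.exp (n * α)) :=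
    trace_mul_posProj (isHermitian_traceB (φ n)) _
  simp only [supSpectralEntropy, supSpectralEntropyEps, infSpectralDivergence, h, sub_zero,
    EReal.coe_one]

theorem dilutionAchievable_of_one_le_liminf (hφ : ∀ n, ‖φ n‖ = 1) {α R : ℝ} (hα : -R ≤ α)
    (h : (1 : EReal) ≤
      liminf (fun n : ℕ => ((spectralWeight (φ n) (Real.exp (n * α)) : ℝ) : EReal)) atTop) :
    DilutionAchievable φ R := by
  set w : ℕ → ℝ := fun n => spectralWeight (φ n) (Real.exp (n * α)) with hw
  have hw1 : Tendsto w atTop (𝓝 1) := by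
    -- The weights never exceed `1`, so the liminf condition already forces convergence.
    refine tendsto_order.mpr ⟨fun c hc => ?_, fun c hc => ?_⟩
    · have hc' : (c : EReal) < 1 := by exact_mod_cast hc
      filter_upwards [eventually_lt_of_lt_liminf (hc'.trans_le h)] with n hn
      exact_mod_cast hn
    · exact Eventually.of_forall fun n => (spectralWeight_le_one (hφ n) _).trans_lt hc
  have hpos : ∀ᶠ n in atTop, 0 < w n := hw1.eventually_const_lt one_pos
  have key (n : ℕ) : ∃ M : ℕ, 1 ≤ M ∧ ∃ L, IsLOCC (dA n) (dB n) M M L ∧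
      (0 < w n → M * Real.exp (n * α) ≤ 1 ∧
        traceNorm (L (pureState (maxEntangled M)) - pureState (φ n)) ≤
          2 * Real.sqrt (2 - 2 * Real.sqrt (w n))) := by
    by_cases hn : 0 < w n
    · obtain ⟨M, hM, hMθ, L, hL, hLe⟩ := exists_isLOCC_traceNorm_le (hφ n) (Real.exp_pos _).le hn
      exact ⟨M, hM, L, hL, fun _ => ⟨hMθ, hLe⟩⟩
    -- Filler for the finitely many `n` of zero weight: with `θ = 0` the weight is `1`, so some
    -- protocol exists.
    · obtain ⟨M, hM, -, L, hL, -⟩ := exists_isLOCC_traceNorm_le (hφ n) le_rfl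
        ((spectralWeight_zero (hφ n)).symm ▸ one_pos)
      exact ⟨M, hM, L, hL, fun h => absurd h hn⟩
  choose M hM L hL hML using key
  refine ⟨M, hM, ⟨L, hL, ?_⟩, ?_⟩
  · have hlim : Tendsto (fun n => 2 * Real.sqrt (2 - 2 * Real.sqrt (w n))) atTop (𝓝 0) := by
      have hc : Continuous fun x : ℝ => 2 * Real.sqrt (2 - 2 * Real.sqrt x) := by fun_prop
      simpa [Function.comp_def] using (hc.tendsto 1).comp hw1
    refine squeeze_zero' (Eventually.of_forall fun n => ?_)
      (hpos.mono fun n hn => (hML n hn).2) hlim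
    -- Only Hermiticity of the output is wanted, to see that the trace norm is nonnegative; `s = 1`
    -- is plain Cauchy–Schwarz.
    have hherm := ((hL n).quadForm_pureState_le (φ := φ n) (s := 1) (M := M n)
      (fun χ _ => by
        have := norm_inner_le_norm (𝕜 := ℂ) χ (φ n)
        rw [hφ n, mul_one] at this
        rw [mul_one]
        gcongr) (maxEntangled (M n)) ((Matrix.rank_le_card_width _).trans (by simp))).1
    rw [traceNorm_eq_sum_abs (hherm.sub (isHermitian_pureState _))]
    positivity
  · refine limsup_le_of_le (by isBoundedDefault) ?_
    filter_upwards [hpos, eventually_gt_atTop 0] with n hn hn0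
    have hn0' : (0 : ℝ) < n := by exact_mod_cast hn0
    have hM0 : (0 : ℝ) < M n := by exact_mod_cast hM n
    have h1 : Real.log (M n) + n * α ≤ 0 := by
      have := Real.log_le_log (by positivity) (hML n hn).1
      rwa [Real.log_mul hM0.ne' (Real.exp_pos _).ne', Real.log_exp, Real.log_one] at this
    rw [EReal.coe_le_coe_iff, one_div, inv_mul_le_iff₀ hn0']
    nlinarith

theorem one_le_liminf_of_dilutionAchievable (hφ : ∀ n, ‖φ n‖ = 1) {α R : ℝ} (hα : α < -R)
    (h : DilutionAchievable φ R) :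
    (1 : EReal) ≤
      liminf (fun n : ℕ => ((spectralWeight (φ n) (Real.exp (n * α)) : ℝ) : EReal)) atTop := by
  obtain ⟨M, hM, ⟨L, hL, hlim⟩, hsup⟩ := h
  -- The slack gives `M n ≤ e^(nR')` eventually, while `R' + α < 0` makes `M n * e^(nα)` vanish.
  obtain ⟨R', hR', hα'⟩ := exists_between (show R < -α by linarith)
  have hev := eventually_lt_of_limsup_lt (hsup.trans_lt (EReal.coe_lt_coe_iff.mpr hR'))
  have hexp : Tendsto (fun n : ℕ => Real.exp (n * (R' + α))) atTop (𝓝 0) :=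
    Real.tendsto_exp_atBot.comp
      (tendsto_natCast_atTop_atTop.atTop_mul_const_of_neg (by linarith))
  have hg := ((tendsto_const_nhds (x := (1 : ℝ))).sub hlim).sub hexp
  rw [sub_zero, sub_zero] at hg
  rw [← EReal.coe_one, ← ((continuous_coe_real_ereal.tendsto _).comp hg).liminf_eq]
  refine liminf_le_liminf ?_
  filter_upwards [hev, eventually_gt_atTop 0] with n hn hn0
  have hn0' : (0 : ℝ) < n := by exact_mod_cast hn0
  have hM0 : (0 : ℝ) < M n := by exact_mod_cast hM n
  have h1 : M n * Real.exp (n * α) ≤ Real.exp (n * (R' + α)) := by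
    rw [mul_add, Real.exp_add]
    gcongr
    rw [EReal.coe_lt_coe_iff, one_div, inv_mul_lt_iff₀ hn0'] at hn
    exact (Real.log_le_iff_le_exp hM0).mp hn.le
  have h2 := (hL n).one_sub_traceNorm_le (hM n) (hφ n) (Real.exp_pos (n * α)).le
  simp only [Function.comp_apply, EReal.coe_le_coe_iff]
  linarith

end Rates

theorem proposition2 (dA dB : ℕ → ℕ) (φ : (n : ℕ) → BipartiteKet (dA n) (dB n))
    (hφ : ∀ n, ‖φ n‖ = 1) :
    dilutionRate φ = supSpectralEntropy (fun n => traceB (pureState (φ n))) := by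
  rw [supSpectralEntropy_traceB]
  refine le_antisymm ?_ ?_
  · rw [← EReal.le_of_forall_lt_iff_le]
    intro R hR
    rw [EReal.neg_lt_comm, lt_sSup_iff] at hR
    obtain ⟨_, ⟨α, hα, rfl⟩, hRα⟩ := hR
    refine sInf_le ⟨R, dilutionAchievable_of_one_le_liminf hφ ?_ hα, rfl⟩
    exact_mod_cast hRα.le
  · refine le_sInf ?_
    rintro _ ⟨R, hR, rfl⟩
    rw [EReal.neg_le]
    -- The converse needs `α < -R` strictly, so `-R` is approached from below by reals.
    refine le_of_forall_lt_imp_le_of_dense fun c hc => ?_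
    obtain ⟨α, hcα, hαR⟩ := EReal.lt_iff_exists_real_btwn.mp hc
    refine hcα.le.trans (le_sSup ⟨α, one_le_liminf_of_dilutionAchievable hφ ?_ hR, rfl⟩)
    exact_mod_cast hαR
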